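/- Let $W$ be a binary-input memoryless channel with an arbitrary output alphabet, and let $I(W)$ denote its symmetric capacity, i.e. the mutual information in bits between a uniform input bit and the channel output. For binary-input channels $W\colon\{0,1\}\to\mathcal Y$ and $V\colon\{0,1\}\to\mathcal Z$ put $$(W,V)^-(y,z\mid x)=\sum_{u\in\{0,1\}}\tfrac12 W(y\mid u+x)V(z\mid u),\qquad (W,V)^+(y,z,u\mid x)=\tfrac12 W(y\mid u+x)V(z\mid x),$$ where $u+x$ is addition modulo $2$, and define $L_0=R_0=W$, $L_{n+1}=(L_n,R_n)^-$, $R_{n+1}=(L_n,R_n)^+$ for $n\ge 0$. Let $h\colon[0,1/2]\to[0,1]$ be the binary entropy function (in bits), $a\ast b=a(1-b)+(1-a)b$, and for $x\in[0,1]$ and $t\in[\max\{0,2x-1\},x]$ let $$f(t,x)=t(2x-t),\qquad g(t,x)=2x-h\big(h^{-1}(t)\ast h^{-1}(2x-t)\big).$$ Let $F_0(x)=G_0(x)=x$, $F_n(x)=f(F_{n-1}(x),x)$ and $G_n(x)=g(G_{n-1}(x),x)$ for $n\ge1$. Then: (a) these iterates are well defined: $F_n(x),G_n(x)\in[\max\{0,2x-1\},x]$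 for all $x\in[0,1]$ and $n\ge0$; (b) $0\le I(W)\le 1$, and for every $n\ge 0$, $$1-G_n(1-I(W))\le I(R_n)\le 1-F_n(1-I(W));$$ (c) the upper bound is attained by the binary erasure channel: if $W$ is the binary erasure channel with erasure probability $\varepsilon\in[0,1]$, then $I(W)=1-\varepsilon$ and $I(R_n)=1-F_n(1-I(W))$ for every $n\ge0$. -/

import Mathlib

open MeasureTheory ProbabilityTheory InformationTheory
open scoped ENNReal

universe u

noncomputable section

/-- A binary-input memoryless channel: an output space together with a Markov kernel that sends
each input bit to the law of the channel output. No assumption is made on the output space. -/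
structure BinaryChannel where
  /-- the output alphabet -/
  Out : Type u
  /-- the measurable structure of the output alphabet -/
  mOut : MeasurableSpace Out
  /-- the transition law -/
  law : Kernel Bool Out
  /-- the transition law is a probability measure for each input -/
  isMarkov : IsMarkovKernel law

attribute [instance] BinaryChannel.mOut BinaryChannel.isMarkov

namespace BinaryChannel

/-- The channel with output laws `m false` and `m true`. -/
def ofLaws {Y : Type u} [MeasurableSpace Y] (m : Bool → Measure Y)
    (hm : ∀ x, IsProbabilityMeasure (m x)) : BinaryChannel.{u} where
  Out := Y
  mOut := inferInstance
  law := Kernel.ofFunOfCountable m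
  isMarkov := ⟨hm⟩

/-- An equal-weight mixture of two probability measures is a probability measure. -/
lemma isProbabilityMeasure_mix {Y : Type u} [MeasurableSpace Y] (m : Bool → Measure Y)
    (hm : ∀ u, IsProbabilityMeasure (m u)) :
    IsProbabilityMeasure (∑ u : Bool, (2⁻¹ : ℝ≥0∞) • m u) := by
  constructor
  simp [ENNReal.inv_two_add_inv_two]

/-- `(W,V)⁻(y,z | x) = ∑ u, (1/2) W(y | u + x) V(z | u)`. -/
def minus (W V : BinaryChannel.{u}) : BinaryChannel.{u} :=
  ofLaws (Y := W.Out × V.Out)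
    (fun x => ∑ u : Bool, (2⁻¹ : ℝ≥0∞) • (W.law (xor u x)).prod (V.law u))
    (fun _ => isProbabilityMeasure_mix _ fun _ => inferInstance)

/-- `(W,V)⁺(y,z,u | x) = (1/2) W(y | u + x) V(z | x)`. -/
def plus (W V : BinaryChannel.{u}) : BinaryChannel.{u} :=
  ofLaws (Y := W.Out × V.Out × Bool)
    (fun x => ∑ u : Bool,
      (2⁻¹ : ℝ≥0∞) • (W.law (xor u x)).prod ((V.law x).prod (Measure.dirac u)))
    (fun _ => isProbabilityMeasure_mix _ fun _ => inferInstance)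

/-- The pair `(L_n, R_n)` of channels after `n` levels of slow polarization. -/
def slow (W : BinaryChannel.{u}) : ℕ → BinaryChannel.{u} × BinaryChannel.{u}
  | 0 => (W, W)
  | n + 1 => (minus (slow W n).1 (slow W n).2, plus (slow W n).1 (slow W n).2)

/-- The bad channel `L_n`. -/
def L (W : BinaryChannel.{u}) (n : ℕ) : BinaryChannel.{u} := (slow W n).1

/-- The good channel `R_n`. -/
def R (W : BinaryChannel.{u}) (n : ℕ) : BinaryChannel.{u} := (slow W n).2

/-- The uniform distribution on the input alphabet. -/
def uniformInput : Measure Bool := uniformOn Set.univ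

/-- The symmetric capacity `I(W)`: the mutual information, in bits, between a uniform input and
the corresponding channel output. -/
def I (W : BinaryChannel.{u}) : ℝ :=
  (klDiv (uniformInput ⊗ₘ W.law) (uniformInput.prod (W.law ∘ₘ uniformInput))).toReal / Real.log 2

/-- The binary erasure channel with erasure probability `ε`; the output `none` is the erasure. -/
def bec (ε : unitInterval) : BinaryChannel.{0} :=
  @ofLaws (Option Bool) ⊤
    (fun x => ENNReal.ofReal (1 - ε) • @Measure.dirac _ ⊤ (some x)
      + ENNReal.ofReal ε • @Measure.dirac _ ⊤ none)
    (fun x => by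
      let _ : MeasurableSpace (Option Bool) := ⊤
      constructor
      have h0 : (0 : ℝ) ≤ ε := ε.2.1
      have h1 : (0 : ℝ) ≤ 1 - ε := sub_nonneg.2 ε.2.2
      simp [← ENNReal.ofReal_add h1 h0])

end BinaryChannel

namespace SlowPolarization

/-- The binary entropy function, in bits. -/
def h (p : ℝ) : ℝ := Real.binEntropy p / Real.log 2

/-- The inverse of the restriction `h : [0,1/2] → [0,1]`. -/
def hInv : ℝ → ℝ := Function.invFunOn h (Set.Icc 0 (1 / 2))

/-- The binary convolution `a ∗ b`. -/
def conv (a b : ℝ) : ℝ := a * (1 - b) + (1 - a) * b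

/-- `f(t,x) = t (2x - t)`. -/
def f (t x : ℝ) : ℝ := t * (2 * x - t)

/-- `g(t,x) = 2x - h(h⁻¹(t) ∗ h⁻¹(2x - t))`. -/
def g (t x : ℝ) : ℝ := 2 * x - h (conv (hInv t) (hInv (2 * x - t)))

/-- The domain `[max{0, 2x - 1}, x]` of `f(·,x)` and `g(·,x)`. -/
def dom (x : ℝ) : Set ℝ := Set.Icc (max 0 (2 * x - 1)) x

/-- `F_0(x) = x` and `F_n(x) = f(F_{n-1}(x), x)`. -/
def F : ℕ → ℝ → ℝ
  | 0, x => x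
  | n + 1, x => f (F n x) x

/-- `G_0(x) = x` and `G_n(x) = g(G_{n-1}(x), x)`. -/
def G : ℕ → ℝ → ℝ
  | 0, x => x
  | n + 1, x => g (G n x) x

end SlowPolarization

end

/-!
Everything is expressed through the *bias* `δ` of a channel, the difference of the two posterior
probabilities of a uniform input bit given the output. If `cap x` denotes the capacity of the binary
symmetric channel with crossover probability `(1 - x) / 2`, then `I(W)` is the mean of `cap δ`
(`IsBias.I_eq`). The bias of `(W, V)⁻` is the product of the biases of `W` and `V`, and that of
`(W, V)⁺` is given by Bayes' rule; a pointwise identity then yields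
`I((W, V)⁻) + I((W, V)⁺) = I(W) + I(V)` (`I_minus_add_I_plus`). Consequently
`I(L_n) + I(R_n) = 2 I(W)`, and only bounds for `I((W, V)⁻)` in terms of `I(W)` and `I(V)` are needed.

Both bounds come from a single fact: for fixed `b ∈ [0, 1]`, `cap (b * x)` is a concave function of
`cap x`, since the ratio `artanh (b x) / artanh x` of the derivatives, up to a constant, is antitone
(`exists_cap_mul_le`). The chord gives `cap x * cap y ≤ cap (x * y)`, hence `I(W) I(V) ≤ I((W, V)⁻)`,
with equality if the biases only take the values `0`, `1` and `-1`, as they do for erasure channels.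
The tangents give Jensen's inequality, which applied to one variable after the other is
`I((W, V)⁻) ≤ cap (a * b)` for `cap a = I(W)` and `cap b = I(V)`, that is, Mrs. Gerber's lemma
(`I_minus_le`).

Writing `x = 1 - I(W)` and `t = 1 - I(R_n)`, these bounds become
`f(t, x) ≤ 1 - I(R_{n+1}) ≤ g(t, x)`, and they iterate because `f` and `g` are increasing in
`t ≤ x`. For `g` this is `mul_le_mul_of_cap_add_eq`: at constant total capacity, the product of two
biases grows when they approach each other, because `x cap'(x)` is increasing, so that `cap` is
convex as a function of `log x`.
-/

namespace SlowPolarization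

open Set Real

/-! ### The capacity of a binary symmetric channel as a function of its bias -/

/-- If the derivative of `f` is a nonnegative function times an antitone one, then it changes sign
at most once, from positive to negative, so that `f` is quasiconcave. -/
lemma min_le_of_hasDerivAt_mul {f p q : ℝ → ℝ} {a b x : ℝ}
    (hf : ContinuousOn f (Icc a b)) (hd : ∀ y ∈ Ioo a b, HasDerivAt f (p y * q y) y)
    (hp : ∀ y ∈ Ioo a b, 0 ≤ p y) (hq : AntitoneOn q (Ioo a b)) (hx : x ∈ Icc a b) :
    min (f a) (f b) ≤ f x := by
  by_contra! hlt
  obtain ⟨ha, hb⟩ := lt_min_iff.1 hlt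
  have hax : a < x := lt_of_le_of_ne hx.1 (by rintro rfl; exact lt_irrefl _ ha)
  have hxb : x < b := lt_of_le_of_ne hx.2 (by rintro rfl; exact lt_irrefl _ hb)
  obtain ⟨c, hc, hc'⟩ := exists_hasDerivAt_eq_slope f (fun y => p y * q y) hax
    (hf.mono (Icc_subset_Icc_right hx.2)) fun y hy => hd y ⟨hy.1, hy.2.trans hxb⟩
  obtain ⟨d, hd0, hd'⟩ := exists_hasDerivAt_eq_slope f (fun y => p y * q y) hxb
    (hf.mono (Icc_subset_Icc_left hx.1)) fun y hy => hd y ⟨hax.trans hy.1, hy.2⟩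
  have hcm : c ∈ Ioo a b := ⟨hc.1, hc.2.trans hxb⟩
  have hdm : d ∈ Ioo a b := ⟨hax.trans hd0.1, hd0.2⟩
  have h1 : p c * q c < 0 := hc' ▸ div_neg_of_neg_of_pos (by linarith) (by linarith)
  have h2 : 0 < p d * q d := hd' ▸ div_pos (by linarith) (by linarith)
  have h3 := hq hcm hdm (hc.2.trans hd0.1).le
  have h4 := hp c hcm
  have h5 := hp d hdm
  have h6 : q c < 0 := by by_contra! hh; exact absurd (mul_nonneg h4 hh) (not_le.2 h1)
  have h7 : 0 < q d := by
    by_contra! hh; exact absurd (mul_nonpos_of_nonneg_of_nonpos h5 hh) (not_le.2 h2)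
  linarith

/-- `logOdds x = 2 artanh x`: the logarithm of the likelihood ratio of two hypotheses whose
posterior probabilities are `(1 + x) / 2` and `(1 - x) / 2`. -/
noncomputable def logOdds (x : ℝ) : ℝ := log (1 + x) - log (1 - x)

@[simp] lemma logOdds_zero : logOdds 0 = 0 := by simp [logOdds]

lemma hasDerivAt_logOdds {x : ℝ} (h0 : -1 < x) (h1 : x < 1) :
    HasDerivAt logOdds (2 / (1 - x ^ 2)) x := by
  have e1 : 1 + x ≠ 0 := by linarith
  have e2 : 1 - x ≠ 0 := by linarith
  have e3 : 1 - x ^ 2 ≠ 0 := by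
    rw [show 1 - x ^ 2 = (1 + x) * (1 - x) by ring]; exact mul_ne_zero e1 e2
  have d1 := ((hasDerivAt_id x).const_add 1).log e1
  have d2 := ((hasDerivAt_id x).const_sub 1).log e2
  refine (d1.sub d2).congr_deriv ?_
  simp only [id]
  field_simp
  ring

lemma strictMonoOn_logOdds : StrictMonoOn logOdds (Ioo (-1) 1) := by
  intro x hx y hy hxy
  have h1 := log_lt_log (by linarith [hx.1]) (by linarith : 1 + x < 1 + y)
  have h2 := log_lt_log (by linarith [hy.2]) (by linarith : 1 - y < 1 - x)
  unfold logOdds; linarith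

lemma logOdds_pos {x : ℝ} (h0 : 0 < x) (h1 : x < 1) : 0 < logOdds x := by
  simpa using strictMonoOn_logOdds ⟨by norm_num, by norm_num⟩ ⟨by linarith, h1⟩ h0

/-- The ratio `artanh (b x) / artanh x` is antitone in `x`. The difference of the two sides, with `y`
fixed, vanishes at `x = 0` and at `x = y`, and it is quasiconcave because the quotient of the
derivatives of `artanh (b x)` and `artanh x` is `b (1 - x²) / (1 - b² x²)`, which is antitone. -/
lemma logOdds_mul_le {b x y : ℝ} (hb0 : 0 ≤ b) (hb1 : b ≤ 1) (hx : 0 ≤ x) (hxy : x ≤ y)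
    (hy : y < 1) : logOdds (b * y) * logOdds x ≤ logOdds (b * x) * logOdds y := by
  rcases hx.eq_or_lt with rfl | hx0
  · simp
  have hy0 : 0 < y := hx0.trans_le hxy
  have key := min_le_of_hasDerivAt_mul
    (f := fun z => logOdds (b * z) * logOdds y - logOdds (b * y) * logOdds z)
    (p := fun z => 2 / (1 - z ^ 2))
    (q := fun z => b * (1 - z ^ 2) / (1 - (b * z) ^ 2) * logOdds y - logOdds (b * y))
    (a := 0) (b := y) (x := x) ?_ ?_ ?_ ?_ ⟨hx, hxy⟩
  · simpa [sub_nonneg, mul_comm] using key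
  all_goals
    have hbz : ∀ z, 0 ≤ z → z ≤ y → b * z < 1 := fun z h0 h1 => by nlinarith
  · refine fun z hz => ContinuousAt.continuousWithinAt ?_
    have hbz0 := mul_nonneg hb0 hz.1
    have c1 := (hasDerivAt_logOdds (x := b * z) (by linarith) (hbz z hz.1 hz.2)).continuousAt
    have c2 := (hasDerivAt_logOdds (x := z) (by linarith [hz.1]) (by linarith [hz.2])).continuousAt
    have c3 : ContinuousAt (fun z => logOdds (b * z)) z :=
      ContinuousAt.comp (f := fun z => b * z) c1 (by fun_prop)
    exact (c3.mul continuousAt_const).sub (continuousAt_const.mul c2)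
  · intro z hz
    have hbz0 := mul_nonneg hb0 hz.1.le
    have hbz1 := hbz z hz.1.le hz.2.le
    have c1 := hasDerivAt_logOdds (x := b * z) (by linarith) hbz1
    have c2 := hasDerivAt_logOdds (x := z) (by linarith [hz.1]) (by linarith [hz.2])
    have c3 : HasDerivAt (fun z => logOdds (b * z)) (2 / (1 - (b * z) ^ 2) * b) z := by
      have := HasDerivAt.comp z c1 ((hasDerivAt_id z).const_mul b)
      simpa [Function.comp_def] using this
    refine ((c3.mul_const (logOdds y)).sub (c2.const_mul (logOdds (b * y)))).congr_deriv ?_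
    have e1 : 1 - z ^ 2 ≠ 0 := by nlinarith [hz.1, hz.2]
    have e2 : 1 - (b * z) ^ 2 ≠ 0 := by nlinarith [hz.1, hz.2]
    field_simp
  · intro z hz
    have : 0 < 1 - z ^ 2 := by nlinarith [hz.1, hz.2]
    positivity
  · intro z hz w hw hzw
    have hL := (logOdds_pos hy0 hy).le
    have hbz0 := mul_nonneg hb0 hz.1.le
    have hbw0 := mul_nonneg hb0 hw.1.le
    have hbz1 := hbz z hz.1.le hz.2.le
    have hbw1 := hbz w hw.1.le hw.2.le
    have e1 : 0 < 1 - (b * z) ^ 2 := by nlinarith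
    have e2 : 0 < 1 - (b * w) ^ 2 := by nlinarith
    have : b * (1 - w ^ 2) / (1 - (b * w) ^ 2) ≤ b * (1 - z ^ 2) / (1 - (b * z) ^ 2) := by
      rw [div_le_div_iff₀ e2 e1, mul_assoc, mul_assoc]
      refine mul_le_mul_of_nonneg_left ?_ hb0
      have hsq : z ^ 2 ≤ w ^ 2 := pow_le_pow_left₀ hz.1.le hzw 2
      have hb2 : b ^ 2 ≤ 1 := pow_le_one₀ hb0 hb1
      nlinarith [mul_nonneg (sub_nonneg.2 hsq) (sub_nonneg.2 hb2)]
    have := mul_le_mul_of_nonneg_right this hL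
    simpa using this

/-- The symmetric capacity of a binary symmetric channel whose output has bias `x`, that is, whose
crossover probability is `(1 - x) / 2`. -/
noncomputable def cap (x : ℝ) : ℝ := 1 - h ((1 - x) / 2)

lemma zero_lt_log_two : 0 < log 2 := log_pos one_lt_two

lemma continuous_cap : Continuous cap := by
  unfold cap h; fun_prop

lemma cap_neg (x : ℝ) : cap (-x) = cap x := by
  unfold cap h
  rw [show (1 - -x) / 2 = 1 - (1 - x) / 2 by ring, binEntropy_one_sub]

lemma cap_abs (x : ℝ) : cap |x| = cap x := by
  rcases abs_choice x with h | h <;> simp [h, cap_neg]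

@[simp] lemma cap_zero : cap 0 = 0 := by
  simp [cap, h, show (1 / 2 : ℝ) = 2⁻¹ by norm_num, zero_lt_log_two.ne']

@[simp] lemma cap_one : cap 1 = 1 := by simp [cap, h]

lemma strictMonoOn_cap : StrictMonoOn cap (Icc 0 1) := by
  intro x hx y hy hxy
  have := binEntropy_strictMonoOn (a := (1 - y) / 2) (b := (1 - x) / 2)
    ⟨by linarith [hy.2], by linarith [hy.1]⟩ ⟨by linarith [hx.2], by linarith [hx.1]⟩ (by linarith)
  have := div_lt_div_of_pos_right this zero_lt_log_two
  unfold cap h; linarith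

lemma cap_mem {x : ℝ} (hx : |x| ≤ 1) : cap x ∈ Icc (0 : ℝ) 1 := by
  rw [← cap_abs]
  have hm : |x| ∈ Icc (0 : ℝ) 1 := ⟨abs_nonneg x, hx⟩
  constructor
  · simpa using strictMonoOn_cap.monotoneOn ⟨le_rfl, zero_le_one⟩ hm hm.1
  · simpa using strictMonoOn_cap.monotoneOn hm ⟨zero_le_one, le_rfl⟩ hm.2

lemma exists_cap_eq {t : ℝ} (ht : t ∈ Icc (0 : ℝ) 1) : ∃ x ∈ Icc (0 : ℝ) 1, cap x = t := by
  have := intermediate_value_Icc zero_le_one continuous_cap.continuousOn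
  rw [cap_zero, cap_one] at this
  exact this ht

lemma hasDerivAt_cap {x : ℝ} (h0 : -1 < x) (h1 : x < 1) :
    HasDerivAt cap (logOdds x / (2 * log 2)) x := by
  have e0 : (1 - x) / 2 ≠ 0 := by linarith
  have e1 : (1 - x) / 2 ≠ 1 := by linarith
  have d1 : HasDerivAt (fun x : ℝ => (1 - x) / 2) (-1 / 2) x :=
    ((hasDerivAt_id x).const_sub 1).div_const 2
  have d2 := HasDerivAt.comp x (hasDerivAt_binEntropy e0 e1) d1
  refine ((d2.div_const (log 2)).const_sub 1).congr_deriv ?_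
  rw [show 1 - (1 - x) / 2 = (1 + x) / 2 by ring, log_div (by linarith) two_ne_zero,
    log_div (by linarith) two_ne_zero, logOdds]
  field_simp
  ring

/-- The formula holds for every real `x`, by the junk values of `log` at nonpositive numbers. -/
lemma cap_mul_log_two (x : ℝ) :
    cap x * log 2 = ((1 + x) * log (1 + x) + (1 - x) * log (1 - x)) / 2 := by
  have key : ∀ y : ℝ, y / 2 * log (y / 2)⁻¹ = y / 2 * (log 2 - log y) := by
    intro y
    rcases eq_or_ne y 0 with rfl | hy
    · simp
    · rw [log_inv, log_div hy two_ne_zero]; ring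
  have : h ((1 - x) / 2) * log 2 = (1 - x) / 2 * (log 2 - log (1 - x))
      + (1 + x) / 2 * (log 2 - log (1 + x)) := by
    rw [h, div_mul_cancel₀ _ zero_lt_log_two.ne', binEntropy, key,
      show 1 - (1 - x) / 2 = (1 + x) / 2 by ring, key]
  rw [cap, sub_mul, this]; ring

/-- Mrs. Gerber's lemma in differential form: as a function of `cap x`, `cap (b * x)` lies below its
tangent at `x₀`. The slope `c` of the tangent is the quotient of the two derivatives at `x₀`, and
`logOdds_mul_le` says that this quotient is antitone, which is concavity. -/
lemma exists_cap_mul_le {b x₀ : ℝ} (hb0 : 0 ≤ b) (hb1 : b ≤ 1) (hx0 : 0 < x₀) (hx1 : x₀ < 1) :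
    ∃ c, ∀ x ∈ Icc (0 : ℝ) 1, cap (b * x) ≤ cap (b * x₀) + c * (cap x - cap x₀) := by
  have hB := logOdds_pos hx0 hx1
  set c := b * logOdds (b * x₀) / logOdds x₀ with hc
  refine ⟨c, ?_⟩
  set D : ℝ → ℝ := fun x => c * cap x - cap (b * x) with hD
  have hcont : Continuous D :=
    (continuous_cap.const_mul c).sub (continuous_cap.comp (continuous_const.mul continuous_id))
  have hder : ∀ x ∈ Ioo (0 : ℝ) 1,
      HasDerivAt D ((c * logOdds x - b * logOdds (b * x)) / (2 * log 2)) x := by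
    intro x hx
    have hbx0 := mul_nonneg hb0 hx.1.le
    have hbx1 : b * x < 1 := by nlinarith [hx.1, hx.2]
    have d1 := hasDerivAt_cap (x := x) (by linarith [hx.1]) hx.2
    have d2 := HasDerivAt.comp x (hasDerivAt_cap (x := b * x) (by linarith) hbx1)
      ((hasDerivAt_id x).const_mul b)
    refine ((d1.const_mul c).sub d2).congr_deriv ?_
    ring
  have hmin : ∀ x ∈ Icc (0 : ℝ) 1, D x₀ ≤ D x := by
    intro x hx
    have hl := zero_lt_log_two
    rcases lt_trichotomy x x₀ with hlt | rfl | hlt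
    · obtain ⟨y, hy, hy'⟩ := exists_hasDerivAt_eq_slope D _ hlt hcont.continuousOn
        fun y hy => hder y ⟨hx.1.trans_lt hy.1, hy.2.trans hx1⟩
      have h1 := logOdds_mul_le hb0 hb1 (hx.1.trans hy.1.le) hy.2.le hx1
      have h2 : c * logOdds y - b * logOdds (b * y) ≤ 0 := by
        rw [hc, sub_nonpos, div_mul_eq_mul_div, div_le_iff₀ hB]
        nlinarith [mul_le_mul_of_nonneg_left h1 hb0]
      have h3 : (c * logOdds y - b * logOdds (b * y)) / (2 * log 2) ≤ 0 :=
        div_nonpos_of_nonpos_of_nonneg h2 (by positivity)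
      rw [hy'] at h3
      by_contra! hh
      exact absurd h3 (not_le.2 (div_pos (by linarith) (by linarith)))
    · rfl
    · obtain ⟨y, hy, hy'⟩ := exists_hasDerivAt_eq_slope D _ hlt hcont.continuousOn
        fun y hy => hder y ⟨hx0.trans hy.1, hy.2.trans_le hx.2⟩
      have h1 := logOdds_mul_le hb0 hb1 hx0.le hy.1.le (hy.2.trans_le hx.2)
      have h2 : 0 ≤ c * logOdds y - b * logOdds (b * y) := by
        rw [hc, sub_nonneg, div_mul_eq_mul_div, le_div_iff₀ hB]
        nlinarith [mul_le_mul_of_nonneg_left h1 hb0]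
      have h3 : 0 ≤ (c * logOdds y - b * logOdds (b * y)) / (2 * log 2) :=
        div_nonneg h2 (by positivity)
      rw [hy'] at h3
      by_contra! hh
      exact absurd h3 (not_le.2 (div_neg_of_neg_of_pos (by linarith) (by linarith)))
  intro x hx
  have := hmin x hx
  simp only [hD] at this
  linarith

/-- As a concave function of `cap x`, `cap (x * y)` lies above its chord, which joins the value `0` at
`cap x = 0` to the value `cap y` at `cap x = 1`. -/
lemma cap_mul_cap_le {x y : ℝ} (hx : |x| ≤ 1) (hy : |y| ≤ 1) : cap x * cap y ≤ cap (x * y) := by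
  rw [← cap_abs x, ← cap_abs y, ← cap_abs (x * y), abs_mul, mul_comm |x|]
  rcases (abs_nonneg x).eq_or_lt with h0 | h0
  · simp [← h0]
  rcases hx.eq_or_lt with h1 | h1
  · simp [h1]
  obtain ⟨c, hc⟩ := exists_cap_mul_le (abs_nonneg y) hy h0 h1
  -- The tangent at `|x|` lies above both endpoints of the chord, hence above the chord.
  have h2 := hc 0 ⟨le_rfl, zero_le_one⟩
  have h3 := hc 1 ⟨zero_le_one, le_rfl⟩
  have h4 := cap_mem (x := |x|) (by simpa using hx)
  simp only [mul_zero, cap_zero, mul_one, cap_one] at h2 h3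
  nlinarith [mul_le_mul_of_nonneg_left h3 h4.1, mul_le_mul_of_nonneg_left h2 (sub_nonneg.2 h4.2)]

lemma mul_logOdds_le {x y : ℝ} (hx : 0 ≤ x) (hxy : x ≤ y) (hy : y < 1) :
    x * logOdds x ≤ y * logOdds y := by
  have h0 := strictMonoOn_logOdds.monotoneOn (a := x) (b := y)
    ⟨by linarith, by linarith⟩ ⟨by linarith, hy⟩ hxy
  have h1 : 0 ≤ logOdds x := by
    rcases hx.eq_or_lt with rfl | hx
    · simp
    · exact (logOdds_pos hx (by linarith)).le
  exact mul_le_mul hxy h0 h1 (hx.trans hxy)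

/-- The derivative of `cap` with respect to `log x` is `x * logOdds x / (2 * log 2)`. -/
lemma cap_sub_eq_log {x y : ℝ} (hx : 0 < x) (hxy : x < y) (hy : y ≤ 1) :
    ∃ z ∈ Ioo x y, cap y - cap x = z * logOdds z / (2 * log 2) * (log y - log x) := by
  have hl := zero_lt_log_two
  obtain ⟨z, hz, he⟩ := exists_ratio_hasDerivAt_eq_ratio_slope cap
    (fun z => logOdds z / (2 * log 2)) hxy continuous_cap.continuousOn
    (fun z hz => hasDerivAt_cap (by linarith [hz.1]) (by linarith [hz.2]))
    log (fun z => z⁻¹)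
    (continuousOn_log.mono fun z hz => by simpa using (hx.trans_le hz.1).ne')
    (fun z hz => hasDerivAt_log (hx.trans hz.1).ne')
  refine ⟨z, hz, ?_⟩
  have : z ≠ 0 := (hx.trans hz.1).ne'
  field_simp at he ⊢
  linarith

/-- At constant total capacity the product of two biases increases when they approach each other,
because `cap` is a convex increasing function of the logarithm of the bias. -/
lemma mul_le_mul_of_cap_add_eq {x₁ y₁ x₂ y₂ : ℝ} (h0 : 0 ≤ y₁) (hy : y₁ ≤ y₂) (hyx : y₂ ≤ x₂)
    (hx : x₂ ≤ x₁) (h1 : x₁ ≤ 1) (he : cap x₁ + cap y₁ = cap x₂ + cap y₂) :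
    x₁ * y₁ ≤ x₂ * y₂ := by
  have hy2 : 0 ≤ y₂ := h0.trans hy
  have hx2 : 0 ≤ x₂ := hy2.trans hyx
  -- The logarithmic comparison needs positive biases and two nontrivial intervals.
  rcases h0.eq_or_lt with rfl | h0
  · simpa using mul_nonneg hx2 hy2
  have hm : ∀ z, y₁ ≤ z → z ≤ x₁ → z ∈ Icc (0 : ℝ) 1 := fun z hz hz' =>
    ⟨h0.le.trans hz, hz'.trans h1⟩
  rcases hx.eq_or_lt with rfl | hx
  · have : y₁ = y₂ := strictMonoOn_cap.injOn (hm _ le_rfl (hy.trans hyx)) (hm _ hy hyx)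
      (by linarith)
    rw [this]
  rcases hy.eq_or_lt with rfl | hy
  · have : x₁ = x₂ := strictMonoOn_cap.injOn (hm _ (hyx.trans hx.le) le_rfl) (hm _ hyx hx.le)
      (by linarith)
    rw [this]
  obtain ⟨ξ, hξ, e1⟩ := cap_sub_eq_log (h0.trans_le (hy.le.trans hyx)) hx h1
  obtain ⟨η, hη, e2⟩ := cap_sub_eq_log h0 hy (hyx.trans (hx.le.trans h1))
  have hl := zero_lt_log_two
  have hη0 : 0 < η := h0.trans hη.1
  have hξ1 : ξ < 1 := hξ.2.trans_le h1
  have hηξ : η ≤ ξ := (hη.2.le.trans hyx).trans hξ.1.le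
  have h2 : η * logOdds η / (2 * log 2) ≤ ξ * logOdds ξ / (2 * log 2) :=
    div_le_div_of_nonneg_right (mul_logOdds_le hη0.le hηξ hξ1) (by positivity)
  have h3 : 0 < η * logOdds η / (2 * log 2) :=
    div_pos (mul_pos hη0 (logOdds_pos hη0 (hηξ.trans_lt hξ1))) (by positivity)
  have hy2' := h0.trans hy
  have hx2' := hy2'.trans_le hyx
  have h4 : 0 ≤ log x₁ - log x₂ := sub_nonneg.2 (log_le_log hx2' hx.le)
  have h5 : log x₁ - log x₂ ≤ log y₂ - log y₁ := by
    refine le_of_mul_le_mul_left ?_ h3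
    have := mul_le_mul_of_nonneg_right h2 h4
    linarith
  have hx1' := hx2'.trans hx
  rw [← log_le_log_iff (mul_pos hx1' h0) (mul_pos hx2' hy2'), log_mul hx1'.ne' h0.ne',
    log_mul hx2'.ne' hy2'.ne']
  linarith

end SlowPolarization

namespace BinaryChannel

open SlowPolarization (cap)

/-! ### Symmetric capacity as the mean capacity of the posterior -/

/-- The sign of an input bit, `0 ↦ 1` and `1 ↦ -1`. -/
def sgn (x : Bool) : ℝ := if x then -1 else 1

@[simp] lemma sgn_false : sgn false = 1 := rfl

@[simp] lemma sgn_true : sgn true = -1 := rfl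

lemma sgn_xor (u x : Bool) : sgn (xor u x) = sgn u * sgn x := by
  cases u <;> cases x <;> simp

lemma abs_sgn (x : Bool) : |sgn x| = 1 := by cases x <;> simp

lemma one_add_nonneg {t : ℝ} (ht : |t| ≤ 1) : 0 ≤ 1 + t := by linarith [(abs_le.1 ht).1]

lemma abs_mul_le_one {s t : ℝ} (hs : |s| ≤ 1) (ht : |t| ≤ 1) : |s * t| ≤ 1 := by
  rw [abs_mul]; exact mul_le_one₀ hs (abs_nonneg t) ht

lemma abs_sgn_mul_le (x : Bool) {t : ℝ} (ht : |t| ≤ 1) : |sgn x * t| ≤ 1 :=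
  abs_mul_le_one (abs_sgn x).le ht

lemma sum_half_withDensity {Y : Type*} [MeasurableSpace Y] {μ : Measure Y} (p : Bool → Y → ℝ)
    (hp : ∀ u, Measurable (p u)) (h0 : ∀ u y, 0 ≤ p u y) :
    ∑ u : Bool, (2⁻¹ : ℝ≥0∞) • μ.withDensity (fun y => ENNReal.ofReal (p u y)) =
      μ.withDensity fun y => ENNReal.ofReal ((p false y + p true y) / 2) := by
  have hm : ∀ u, Measurable fun y => ENNReal.ofReal (p u y) := fun u => (hp u).ennreal_ofReal
  rw [Fintype.sum_bool, ← withDensity_smul _ (hm _), ← withDensity_smul _ (hm _),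
    ← withDensity_add_left ((hm _).const_smul _)]
  congr 1
  funext y
  have h2 : (2⁻¹ : ℝ≥0∞) = ENNReal.ofReal 2⁻¹ := by
    rw [ENNReal.ofReal_inv_of_pos two_pos]; simp
  simp only [Pi.add_apply, Pi.smul_apply, smul_eq_mul, h2]
  rw [← ENNReal.ofReal_mul (by norm_num), ← ENNReal.ofReal_mul (by norm_num),
    ← ENNReal.ofReal_add (mul_nonneg (by norm_num) (h0 _ _)) (mul_nonneg (by norm_num) (h0 _ _))]
  congr 1
  ring

/-- The law of the channel output under a uniform input. -/
noncomputable def outLaw (W : BinaryChannel.{u}) : Measure W.Out :=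
  ∑ x : Bool, (2⁻¹ : ℝ≥0∞) • W.law x

instance (W : BinaryChannel.{u}) : IsProbabilityMeasure W.outLaw :=
  isProbabilityMeasure_mix _ fun _ => inferInstance

lemma uniformInput_singleton (x : Bool) : uniformInput {x} = 2⁻¹ := by
  rw [uniformInput, uniformOn_univ]
  simp

instance : IsProbabilityMeasure uniformInput :=
  inferInstanceAs (IsProbabilityMeasure (uniformOn Set.univ))

lemma comp_uniformInput (W : BinaryChannel.{u}) : W.law ∘ₘ uniformInput = W.outLaw := by
  simp [Measure.comp_eq_sum_of_countable, uniformInput_singleton, outLaw, Measure.sum_fintype]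

/-- `δ` is a version of the bias `P(X = 0 | Y) - P(X = 1 | Y)` of the uniform input `X` given the
output `Y` of `W`, with values in `[-1, 1]` everywhere. -/
structure IsBias (W : BinaryChannel.{u}) (δ : W.Out → ℝ) : Prop where
  measurable : Measurable δ
  abs_le_one : ∀ y, |δ y| ≤ 1
  law_eq : ∀ x, W.law x = W.outLaw.withDensity fun y => ENNReal.ofReal (1 + sgn x * δ y)

/-- A bias may be computed with respect to any measure `μ` in place of the law of the output,
since `μ` is then that law. -/
lemma isBias_of_law_eq {W : BinaryChannel.{u}} {μ : Measure W.Out} {δ : W.Out → ℝ}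
    (hm : Measurable δ) (h1 : ∀ y, |δ y| ≤ 1)
    (hl : ∀ x, W.law x = μ.withDensity fun y => ENNReal.ofReal (1 + sgn x * δ y)) :
    W.outLaw = μ ∧ IsBias W δ := by
  have : W.outLaw = μ := by
    simp only [outLaw, hl]
    rw [sum_half_withDensity (fun x y => 1 + sgn x * δ y) (fun x => by fun_prop)
      fun x y => one_add_nonneg (abs_sgn_mul_le x (h1 y))]
    have h : ∀ y, (1 + sgn false * δ y + (1 + sgn true * δ y)) / 2 = 1 := fun y => by
      simp only [sgn_false, sgn_true]; ring
    simp only [h, ENNReal.ofReal_one]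
    exact withDensity_one
  exact ⟨this, hm, h1, by rwa [this]⟩

lemma integrable_cap {Y : Type*} [MeasurableSpace Y] {μ : Measure Y} [IsFiniteMeasure μ]
    {δ : Y → ℝ} (hm : Measurable δ) (h1 : ∀ y, |δ y| ≤ 1) : Integrable (fun y => cap (δ y)) μ := by
  refine Integrable.of_bound
    (SlowPolarization.continuous_cap.measurable.comp hm).aestronglyMeasurable 1 (.of_forall fun y => ?_)
  have := SlowPolarization.cap_mem (h1 y)
  rw [Real.norm_eq_abs, abs_of_nonneg this.1]
  exact this.2

/-- The symmetric capacity is the mean over the outputs of the capacity of the binary symmetric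
channel with the same posterior: `1 + sgn x * δ y` is the density of the joint law with respect to
the product of its marginals. -/
theorem IsBias.I_eq {W : BinaryChannel.{u}} {δ : W.Out → ℝ} (hδ : IsBias W δ) :
    W.I = ∫ y, cap (δ y) ∂W.outLaw := by
  have hδm := hδ.measurable
  set d : Bool × W.Out → ℝ≥0∞ := fun p => ENNReal.ofReal (1 + sgn p.1 * δ p.2) with hd
  have hsgn : Measurable fun p : Bool × W.Out => sgn p.1 :=
    (measurable_of_countable sgn).comp measurable_fst
  have hdr : Measurable fun p : Bool × W.Out => 1 + sgn p.1 * δ p.2 :=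
    measurable_const.add (hsgn.mul (hδm.comp measurable_snd))
  have hdm : Measurable d := hdr.ennreal_ofReal
  have hjoint : uniformInput ⊗ₘ W.law = (uniformInput.prod W.outLaw).withDensity d := by
    ext s hs
    rw [Measure.compProd_apply hs, withDensity_apply _ hs, ← lintegral_indicator hs,
      lintegral_prod _ (hdm.indicator hs).aemeasurable]
    refine lintegral_congr fun x => ?_
    have hsx : MeasurableSet (Prod.mk x ⁻¹' s) := measurable_prodMk_left hs
    rw [hδ.law_eq, withDensity_apply _ hsx, ← lintegral_indicator hsx]
    rfl
  obtain ⟨C, hC⟩ := isCompact_Icc.exists_bound_of_continuousOn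
    (continuous_klFun.continuousOn (s := Set.Icc 0 2))
  have hbound : ∀ x y, ‖klFun (1 + sgn x * δ y)‖ ≤ C := by
    intro x y
    have := abs_le.1 (abs_sgn_mul_le x (hδ.abs_le_one y))
    exact hC _ ⟨by linarith, by linarith⟩
  have hklint : Integrable (fun p : Bool × W.Out => klFun (1 + sgn p.1 * δ p.2))
      (uniformInput.prod W.outLaw) :=
    Integrable.of_bound (measurable_klFun.comp hdr).aestronglyMeasurable C
      (.of_forall fun p => hbound p.1 p.2)
  have hkl : ∀ x, Integrable (fun y => klFun (1 + sgn x * δ y)) W.outLaw := fun x =>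
    Integrable.of_bound (measurable_klFun.comp
      (by fun_prop : Measurable fun y => 1 + sgn x * δ y)).aestronglyMeasurable C
      (.of_forall (hbound x))
  have hfin : IsFiniteMeasure ((uniformInput.prod W.outLaw).withDensity d) := by
    rw [← hjoint]; infer_instance
  rw [I, comp_uniformInput, hjoint,
    toReal_klDiv_eq_integral_klFun (withDensity_absolutelyContinuous _ _),
    div_eq_iff SlowPolarization.zero_lt_log_two.ne', ← integral_mul_const]
  rw [integral_congr_ae (g := fun p => klFun (1 + sgn p.1 * δ p.2)), integral_prod _ hklint,
    integral_fintype .of_finite]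
  · simp only [Fintype.sum_bool, measureReal_def, uniformInput_singleton, smul_eq_mul]
    rw [← integral_const_mul, ← integral_const_mul,
      ← integral_add ((hkl _).const_mul _) ((hkl _).const_mul _)]
    refine integral_congr_ae (.of_forall fun y => ?_)
    simp only [SlowPolarization.cap_mul_log_two, klFun_apply, ENNReal.toReal_inv,
      ENNReal.toReal_ofNat, sgn_true, sgn_false, one_mul, neg_one_mul]
    ring_nf
  · filter_upwards [Measure.rnDeriv_withDensity (uniformInput.prod W.outLaw) hdm] with p hp
    rw [hp, hd, ENNReal.toReal_ofReal
      (one_add_nonneg (abs_sgn_mul_le p.1 (hδ.abs_le_one p.2)))]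

/-- The bias is obtained from the Radon–Nikodym derivative of the law of the output given the input
`0`, which exists because half of this law is dominated by the law of the output. No regularity of
the output space is needed. -/
theorem exists_isBias (W : BinaryChannel.{u}) : ∃ δ, IsBias W δ := by
  set r := ((2⁻¹ : ℝ≥0∞) • W.law false).rnDeriv W.outLaw with hr
  have hle : (2⁻¹ : ℝ≥0∞) • W.law false ≤ W.outLaw := by
    rw [outLaw, Fintype.sum_bool]
    exact Measure.le_add_left le_rfl
  have hr1 : r ≤ᵐ[W.outLaw] 1 := Measure.rnDeriv_le_one_of_le hle
  have hrm : Measurable r := Measure.measurable_rnDeriv _ _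
  have hwd : W.outLaw.withDensity r = (2⁻¹ : ℝ≥0∞) • W.law false :=
    Measure.withDensity_rnDeriv_eq _ _ (Measure.absolutelyContinuous_of_le hle)
  -- `r ≤ 1` holds almost everywhere only, and the truncation makes `|δ| ≤ 1` hold everywhere.
  set δ : W.Out → ℝ := fun y => 2 * (min (r y) 1).toReal - 1 with hδ
  have hδm : Measurable δ := by
    have := (hrm.min (measurable_const (a := (1 : ℝ≥0∞)))).ennreal_toReal
    fun_prop
  have hδ1 : ∀ y, |δ y| ≤ 1 := by
    intro y
    have h0 : 0 ≤ (min (r y) 1).toReal := ENNReal.toReal_nonneg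
    have h1 : (min (r y) 1).toReal ≤ 1 :=
      ENNReal.toReal_le_of_le_ofReal zero_le_one (by simp)
    rw [abs_le]; constructor <;> simp only [hδ] <;> linarith
  have hP0 : W.law false = W.outLaw.withDensity fun y => ENNReal.ofReal (1 + δ y) := by
    have h2 : W.law false = (2 : ℝ≥0∞) • W.outLaw.withDensity r := by
      rw [hwd, smul_smul, ENNReal.mul_inv_cancel two_ne_zero ENNReal.ofNat_ne_top, one_smul]
    rw [h2, ← withDensity_smul _ hrm]
    refine withDensity_congr_ae ?_
    filter_upwards [hr1] with y hy
    have hy' : r y ≤ 1 := hy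
    simp only [Pi.smul_apply, smul_eq_mul, hδ, min_eq_left hy']
    rw [show 1 + (2 * (r y).toReal - 1) = 2 * (r y).toReal by ring,
      ENNReal.ofReal_mul zero_le_two, ENNReal.ofReal_toReal (hy'.trans_lt ENNReal.one_lt_top).ne]
    simp
  have hP1 : W.law true = W.outLaw.withDensity fun y => ENNReal.ofReal (1 + -δ y) := by
    have hsum := sum_half_withDensity (μ := W.outLaw) (fun x y => 1 + sgn x * δ y)
      (fun x => by fun_prop) fun x y => one_add_nonneg (abs_sgn_mul_le x (hδ1 y))
    simp only [Fintype.sum_bool, sgn_true, sgn_false, one_mul, neg_one_mul, ← hP0] at hsum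
    have h1 : (fun y => ENNReal.ofReal ((1 + δ y + (1 + -δ y)) / 2)) = 1 := by
      funext y
      rw [show (1 + δ y + (1 + -δ y)) / 2 = 1 by ring, ENNReal.ofReal_one, Pi.one_apply]
    have ho : W.outLaw = (2⁻¹ : ℝ≥0∞) • W.law true + (2⁻¹ : ℝ≥0∞) • W.law false := by
      rw [outLaw, Fintype.sum_bool]
    rw [h1, withDensity_one] at hsum
    replace hsum := hsum.trans ho
    ext s hs
    have := congrArg (fun m : Measure W.Out => m s) hsum
    simp only [Measure.add_apply, Measure.smul_apply, smul_eq_mul] at this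
    have h3 := (ENNReal.add_left_inj (ENNReal.mul_ne_top (by simp) (measure_ne_top _ _))).1 this
    exact ((ENNReal.mul_right_inj (by simp) (by simp)).1 h3).symm
  refine ⟨δ, hδm, hδ1, fun x => ?_⟩
  cases x
  · simpa using hP0
  · simpa using hP1

theorem I_mem (W : BinaryChannel.{u}) : W.I ∈ Set.Icc (0 : ℝ) 1 := by
  obtain ⟨δ, hδ⟩ := W.exists_isBias
  rw [hδ.I_eq]
  have hc := fun y => SlowPolarization.cap_mem (hδ.abs_le_one y)
  refine ⟨integral_nonneg fun y => (hc y).1, ?_⟩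
  calc _ ≤ ∫ _, (1 : ℝ) ∂W.outLaw :=
        integral_mono (integrable_cap hδ.measurable hδ.abs_le_one) (integrable_const _)
          fun y => (hc y).2
    _ = 1 := by simp

/-! ### The biases of the two synthesized channels -/

/-- The joint law of the outputs of two independent uses of channels. -/
lemma IsBias.prod_law {W V : BinaryChannel.{u}} {δ : W.Out → ℝ} {ε : V.Out → ℝ} (hδ : IsBias W δ)
    (hε : IsBias V ε) (x x' : Bool) :
    (W.law x).prod (V.law x') = (W.outLaw.prod V.outLaw).withDensity fun p =>
      ENNReal.ofReal ((1 + sgn x * δ p.1) * (1 + sgn x' * ε p.2)) := by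
  have h1 := hδ.measurable
  have h2 := hε.measurable
  rw [hδ.law_eq, hε.law_eq, prod_withDensity (by fun_prop) (by fun_prop)]
  congr 1
  funext p
  rw [ENNReal.ofReal_mul (one_add_nonneg (abs_sgn_mul_le x (hδ.abs_le_one p.1)))]

/-- The bias of a sum of two independent bits is the product of their biases. -/
theorem IsBias.minus {W V : BinaryChannel.{u}} {δ : W.Out → ℝ} {ε : V.Out → ℝ} (hδ : IsBias W δ)
    (hε : IsBias V ε) : (BinaryChannel.minus W V).outLaw = W.outLaw.prod V.outLaw ∧
      IsBias (BinaryChannel.minus W V) fun p : W.Out × V.Out => δ p.1 * ε p.2 := by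
  have h1 := hδ.measurable
  have h2 := hε.measurable
  refine isBias_of_law_eq (W := BinaryChannel.minus W V) (μ := W.outLaw.prod V.outLaw)
    (δ := fun p : W.Out × V.Out => δ p.1 * ε p.2)
    ((h1.comp measurable_fst).mul (h2.comp measurable_snd))
    (fun p => abs_mul_le_one (hδ.abs_le_one _) (hε.abs_le_one _)) fun x => ?_
  change ∑ u : Bool, (2⁻¹ : ℝ≥0∞) • (W.law (xor u x)).prod (V.law u) = _
  simp only [hδ.prod_law hε]
  rw [sum_half_withDensity
    (fun u (p : W.Out × V.Out) => (1 + sgn (xor u x) * δ p.1) * (1 + sgn u * ε p.2))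
    (fun u => by fun_prop)
    fun u p => mul_nonneg (one_add_nonneg (abs_sgn_mul_le _ (hδ.abs_le_one _)))
      (one_add_nonneg (abs_sgn_mul_le _ (hε.abs_le_one _)))]
  congr 1
  funext p
  congr 1
  simp only [sgn_xor, sgn_true, sgn_false]
  ring

lemma I_minus_eq {W V : BinaryChannel.{u}} {δ : W.Out → ℝ} {ε : V.Out → ℝ} (hδ : IsBias W δ)
    (hε : IsBias V ε) :
    (minus W V).I = ∫ p, cap (δ p.1 * ε p.2) ∂(W.outLaw.prod V.outLaw) := by
  obtain ⟨h1, h2⟩ := hδ.minus hε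
  rw [h2.I_eq, h1]
  rfl

/-- The bias of the output `(y, z, u)` of `plus W V`: two conditionally independent observations of
the same input, with biases `± δ y` and `ε z`, are combined by Bayes' rule. Where the denominator
vanishes, which has probability `0`, the value is `0`. -/
noncomputable def plusBias {Y Z : Type*} (δ : Y → ℝ) (ε : Z → ℝ) (p : Y × Z × Bool) : ℝ :=
  (sgn p.2.2 * δ p.1 + ε p.2.1) / (1 + sgn p.2.2 * δ p.1 * ε p.2.1)

lemma abs_div_le_one {a b : ℝ} (ha : |a| ≤ 1) (hb : |b| ≤ 1) : |(a + b) / (1 + a * b)| ≤ 1 := by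
  rw [abs_le] at ha hb
  have h1 : 0 ≤ (1 + a) * (1 + b) := mul_nonneg (by linarith) (by linarith)
  have h2 : 0 ≤ (1 - a) * (1 - b) := mul_nonneg (by linarith) (by linarith)
  rw [abs_div]
  refine div_le_one_of_le₀ ?_ (abs_nonneg _)
  rw [abs_of_nonneg (by linarith : 0 ≤ 1 + a * b), abs_le]
  constructor <;> linarith

/-- Bayes' rule for the combined bias; it remains valid where the denominator vanishes. -/
lemma one_add_mul_one_add_div {a b s : ℝ} (ha : |a| ≤ 1) (hb : |b| ≤ 1) (hs : s ^ 2 = 1) :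
    (1 + a * b) * (1 + s * ((a + b) / (1 + a * b))) = (1 + s * a) * (1 + s * b) := by
  by_cases hz : 1 + a * b = 0
  · -- The observations contradict each other, `a = -b = ±1`, and both sides vanish.
    rw [hz, zero_mul]
    rw [abs_le] at ha hb
    have h1 : 0 ≤ (1 + a) * (1 + b) := mul_nonneg (by linarith) (by linarith)
    have h2 : 0 ≤ (1 - a) * (1 - b) := mul_nonneg (by linarith) (by linarith)
    have : a + b = 0 := by linarith
    linear_combination -hz - s * this - (a * b) * hs
  · field_simp
    linear_combination -(a * b) * hs

lemma plus_law (W V : BinaryChannel.{u}) (x : Bool) : (plus W V).law x =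
    ∑ u : Bool, (2⁻¹ : ℝ≥0∞) • ((W.law (xor u x)).prod (V.law x)).map
      fun p : W.Out × V.Out => (p.1, p.2, u) := by
  change ∑ u : Bool, (2⁻¹ : ℝ≥0∞) •
    (W.law (xor u x)).prod ((V.law x).prod (Measure.dirac u)) = _
  refine Finset.sum_congr rfl fun u _ => ?_
  rw [Measure.prod_dirac]
  conv_lhs => rw [← Measure.map_id (μ := W.law (xor u x))]
  rw [Measure.map_prod_map _ _ measurable_id (by fun_prop)]
  rfl

lemma withDensity_map_eq {Y Z : Type*} [MeasurableSpace Y] [MeasurableSpace Z] {μ : Measure Y}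
    {e : Y → Z} (he : Measurable e) {p : Z → ℝ≥0∞} (hp : Measurable p) :
    (μ.map e).withDensity p = (μ.withDensity fun y => p (e y)).map e := by
  ext s hs
  rw [withDensity_apply _ hs, setLIntegral_map hs hp he, Measure.map_apply he hs,
    withDensity_apply _ (he hs)]

/-- The law of the output of `plus W V` under a uniform input. -/
noncomputable def plusOutLaw {Y Z : Type*} [MeasurableSpace Y] [MeasurableSpace Z] (μ : Measure Y)
    (ν : Measure Z) (δ : Y → ℝ) (ε : Z → ℝ) : Measure (Y × Z × Bool) :=
  ∑ u : Bool, (2⁻¹ : ℝ≥0∞) • ((μ.prod ν).withDensity fun p =>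
    ENNReal.ofReal (1 + sgn u * δ p.1 * ε p.2)).map fun p : Y × Z => (p.1, p.2, u)

lemma measurable_plusBias {Y Z : Type*} [MeasurableSpace Y] [MeasurableSpace Z] {δ : Y → ℝ}
    {ε : Z → ℝ} (hδ : Measurable δ) (hε : Measurable ε) : Measurable (plusBias δ ε) := by
  have hsgn : Measurable sgn := measurable_of_countable sgn
  unfold plusBias
  fun_prop

theorem IsBias.plus {W V : BinaryChannel.{u}} {δ : W.Out → ℝ} {ε : V.Out → ℝ} (hδ : IsBias W δ)
    (hε : IsBias V ε) : (BinaryChannel.plus W V).outLaw = plusOutLaw W.outLaw V.outLaw δ ε ∧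
      IsBias (BinaryChannel.plus W V) (plusBias δ ε) := by
  have h1 := hδ.measurable
  have h2 := hε.measurable
  have hm := measurable_plusBias h1 h2
  refine isBias_of_law_eq (W := BinaryChannel.plus W V) (δ := plusBias δ ε) hm
    (fun p => abs_div_le_one (abs_sgn_mul_le _ (hδ.abs_le_one _)) (hε.abs_le_one _)) fun x => ?_
  rw [plus_law]
  change _ = (plusOutLaw W.outLaw V.outLaw δ ε).withDensity
    fun p : W.Out × V.Out × Bool => ENNReal.ofReal (1 + sgn x * plusBias δ ε p)
  rw [plusOutLaw, Fintype.sum_bool, Fintype.sum_bool, withDensity_add_measure,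
    withDensity_smul_measure, withDensity_smul_measure]
  have key : ∀ u : Bool, ((W.law (xor u x)).prod (V.law x)).map
      (fun p : W.Out × V.Out => (p.1, p.2, u)) =
      (((W.outLaw.prod V.outLaw).withDensity fun p =>
        ENNReal.ofReal (1 + sgn u * δ p.1 * ε p.2)).map
          fun p : W.Out × V.Out => (p.1, p.2, u)).withDensity
        fun p => ENNReal.ofReal (1 + sgn x * plusBias δ ε p) := by
    intro u
    rw [withDensity_map_eq (by fun_prop) (by fun_prop), hδ.prod_law hε,
      ← withDensity_mul _ (by fun_prop) (by fun_prop)]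
    congr 2
    funext p
    have ha := abs_sgn_mul_le u (hδ.abs_le_one p.1)
    have hb := hε.abs_le_one p.2
    rw [Pi.mul_apply, ← ENNReal.ofReal_mul (one_add_nonneg (abs_mul_le_one ha hb))]
    simp only [plusBias]
    rw [one_add_mul_one_add_div ha hb (by rw [← sq_abs, abs_sgn]; norm_num), sgn_xor]
    congr 1
    ring
  rw [key, key]

/-! ### The chain rule -/

lemma mul_div_mul_log_div {m p : ℝ} (hp : m = 0 → p = 0) :
    m * (p / m * Real.log (p / m)) = p * Real.log p - p * Real.log m := by
  by_cases hm : m = 0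
  · simp [hm, hp hm]
  by_cases hp0 : p = 0
  · simp [hp0]
  rw [Real.log_div hp0 hm]
  field_simp

lemma mul_cap_div {a b : ℝ} (ha : |a| ≤ 1) (hb : |b| ≤ 1) :
    (1 + a * b) * cap ((a + b) / (1 + a * b)) * Real.log 2 =
      ((1 + a) * (1 + b) * Real.log ((1 + a) * (1 + b))
        + (1 - a) * (1 - b) * Real.log ((1 - a) * (1 - b))) / 2
        - (1 + a * b) * Real.log (1 + a * b) := by
  rw [mul_assoc, SlowPolarization.cap_mul_log_two]
  rw [abs_le] at ha hb
  have h1 : 0 ≤ (1 + a) * (1 + b) := mul_nonneg (by linarith) (by linarith)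
  have h2 : 0 ≤ (1 - a) * (1 - b) := mul_nonneg (by linarith) (by linarith)
  by_cases hz : 1 + a * b = 0
  · have e1 : (1 + a) * (1 + b) = 0 := by linarith
    have e2 : (1 - a) * (1 - b) = 0 := by linarith
    rw [hz, e1, e2]; simp
  have k1 := mul_div_mul_log_div (m := 1 + a * b) (p := (1 + a) * (1 + b)) fun h => absurd h hz
  have k2 := mul_div_mul_log_div (m := 1 + a * b) (p := (1 - a) * (1 - b)) fun h => absurd h hz
  have e1 : 1 + (a + b) / (1 + a * b) = (1 + a) * (1 + b) / (1 + a * b) := by field_simp; ring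
  have e2 : 1 - (a + b) / (1 + a * b) = (1 - a) * (1 - b) / (1 + a * b) := by field_simp; ring
  rw [e1, e2]
  linear_combination k1 / 2 + k2 / 2

lemma mul_log_mul (x y : ℝ) :
    x * y * Real.log (x * y) = y * (x * Real.log x) + x * (y * Real.log y) := by
  by_cases hx : x = 0
  · simp [hx]
  by_cases hy : y = 0
  · simp [hy]
  rw [Real.log_mul hx hy]; ring

/-- The chain rule of mutual information, conditionally on the outputs of the two channels. -/
lemma cap_chain_rule {a b : ℝ} (ha : |a| ≤ 1) (hb : |b| ≤ 1) :
    ((1 + a * b) * cap ((a + b) / (1 + a * b))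
      + (1 + -a * b) * cap ((-a + b) / (1 + -a * b))) / 2 = cap a + cap b - cap (a * b) := by
  have h1 := mul_cap_div ha hb
  have h2 := mul_cap_div (a := -a) (by rwa [abs_neg]) hb
  have ca := SlowPolarization.cap_mul_log_two a
  have cb := SlowPolarization.cap_mul_log_two b
  have cab := SlowPolarization.cap_mul_log_two (a * b)
  simp only [mul_log_mul] at h1 h2
  rw [show (1 : ℝ) - -a = 1 + a by ring, show (1 : ℝ) + -a = 1 - a by ring] at h2
  rw [show (1 : ℝ) - a * b = 1 + -a * b by ring] at cab
  refine mul_right_cancel₀ SlowPolarization.zero_lt_log_two.ne' ?_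
  linear_combination h1 / 2 + h2 / 2 - ca - cb + cab

/-- Polarization preserves the total symmetric capacity. -/
theorem I_minus_add_I_plus (W V : BinaryChannel.{u}) :
    (minus W V).I + (plus W V).I = W.I + V.I := by
  obtain ⟨δ, hδ⟩ := W.exists_isBias
  obtain ⟨ε, hε⟩ := V.exists_isBias
  have h1 := hδ.measurable
  have h2 := hε.measurable
  obtain ⟨ho, hp⟩ := hδ.plus hε
  have hm := measurable_plusBias h1 h2
  have hcm : Measurable fun p : W.Out × V.Out × Bool => cap (plusBias δ ε p) :=
    SlowPolarization.continuous_cap.measurable.comp hm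
  have hint : ∀ u : Bool, ∫ p, cap (plusBias δ ε p) ∂(((W.outLaw.prod V.outLaw).withDensity
      fun p => ENNReal.ofReal (1 + sgn u * δ p.1 * ε p.2)).map
        fun p : W.Out × V.Out => (p.1, p.2, u)) =
      ∫ p, (1 + sgn u * δ p.1 * ε p.2) * cap (plusBias δ ε (p.1, p.2, u))
        ∂(W.outLaw.prod V.outLaw) := by
    intro u
    rw [integral_map (by fun_prop) hcm.aestronglyMeasurable,
      integral_withDensity_eq_integral_toReal_smul (by fun_prop)
        (.of_forall fun p => ENNReal.ofReal_lt_top)]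
    refine integral_congr_ae (.of_forall fun p => ?_)
    simp only [smul_eq_mul]
    rw [ENNReal.toReal_ofReal (one_add_nonneg
      (abs_mul_le_one (abs_sgn_mul_le u (hδ.abs_le_one p.1)) (hε.abs_le_one p.2)))]
  have hb : ∀ p : W.Out × V.Out × Bool, |plusBias δ ε p| ≤ 1 := hp.abs_le_one
  have hfin : IsFiniteMeasure (plusOutLaw W.outLaw V.outLaw δ ε) := by
    have hf : IsFiniteMeasure (plus W V).outLaw := inferInstance
    rwa [ho] at hf
  have hci : Integrable (fun p => cap (plusBias δ ε p)) (plusOutLaw W.outLaw V.outLaw δ ε) :=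
    integrable_cap hm hb
  have hplus : (plus W V).I = ∫ p, (cap (δ p.1) + cap (ε p.2) - cap (δ p.1 * ε p.2))
      ∂(W.outLaw.prod V.outLaw) := by
    rw [hp.I_eq, ho]
    change ∫ p, cap (plusBias δ ε p) ∂(plusOutLaw W.outLaw V.outLaw δ ε) = _
    unfold plusOutLaw at hci ⊢
    rw [integral_finsetSum_measure fun u hu => (integrable_finsetSum_measure.1 hci) u hu]
    simp only [Fintype.sum_bool, integral_smul_measure, hint, smul_eq_mul]
    have hi : ∀ u : Bool, Integrable (fun p : W.Out × V.Out =>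
        (1 + sgn u * δ p.1 * ε p.2) * cap (plusBias δ ε (p.1, p.2, u)))
        (W.outLaw.prod V.outLaw) := by
      intro u
      refine Integrable.of_bound (Measurable.aestronglyMeasurable
        (.mul (by fun_prop) (hcm.comp (by fun_prop)))) 2 (.of_forall fun p => ?_)
      have k1 := abs_le.1
        (abs_mul_le_one (abs_sgn_mul_le u (hδ.abs_le_one p.1)) (hε.abs_le_one p.2))
      have k2 := SlowPolarization.cap_mem (hb (p.1, p.2, u))
      rw [Real.norm_eq_abs, abs_of_nonneg (mul_nonneg (by linarith) k2.1)]
      nlinarith [k2.1, k2.2]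
    rw [← integral_const_mul, ← integral_const_mul,
      ← integral_add ((hi _).const_mul _) ((hi _).const_mul _)]
    refine integral_congr_ae (.of_forall fun p => ?_)
    simp only [plusBias, sgn_true, sgn_false, one_mul, neg_one_mul,
      ← cap_chain_rule (hδ.abs_le_one p.1) (hε.abs_le_one p.2), ENNReal.toReal_inv,
      ENNReal.toReal_ofNat]
    ring
  have i1 : Integrable (fun p : W.Out × V.Out => cap (δ p.1)) (W.outLaw.prod V.outLaw) :=
    integrable_cap (by fun_prop) fun p => hδ.abs_le_one p.1
  have i2 : Integrable (fun p : W.Out × V.Out => cap (ε p.2)) (W.outLaw.prod V.outLaw) :=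
    integrable_cap (by fun_prop) fun p => hε.abs_le_one p.2
  have i3 : Integrable (fun p : W.Out × V.Out => cap (δ p.1 * ε p.2))
      (W.outLaw.prod V.outLaw) :=
    integrable_cap (by fun_prop) fun p => abs_mul_le_one (hδ.abs_le_one p.1) (hε.abs_le_one p.2)
  have j1 : ∫ p, cap (δ p.1) ∂(W.outLaw.prod V.outLaw) = W.I := by
    rw [hδ.I_eq, integral_fun_fst (f := fun y => cap (δ y))]; simp
  have j2 : ∫ p, cap (ε p.2) ∂(W.outLaw.prod V.outLaw) = V.I := by
    rw [hε.I_eq, integral_fun_snd (f := fun y => cap (ε y))]; simp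
  have i12 : Integrable (fun p : W.Out × V.Out => cap (δ p.1) + cap (ε p.2))
      (W.outLaw.prod V.outLaw) := i1.add i2
  rw [hplus, integral_sub i12 i3, integral_add i1 i2, j1, j2, I_minus_eq hδ hε]
  ring

/-! ### Extremal capacities of the combined channel -/

/-- Jensen's inequality for `cap (x * b)` as a concave function of `cap x`: replacing a random bias by
the constant one with the same mean capacity increases the capacity after multiplication by `b`. -/
lemma integral_cap_mul_le {Y : Type*} [MeasurableSpace Y] {μ : Measure Y} [IsProbabilityMeasure μ]
    {δ : Y → ℝ} (hm : Measurable δ) (h1 : ∀ y, |δ y| ≤ 1) {a b : ℝ} (ha : a ∈ Set.Icc (0 : ℝ) 1)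
    (hb : |b| ≤ 1) (he : cap a = ∫ y, cap (δ y) ∂μ) : ∫ y, cap (δ y * b) ∂μ ≤ cap (a * b) := by
  have hc := fun y => SlowPolarization.cap_mem (h1 y)
  have hi := integrable_cap (μ := μ) hm h1
  have hib : Integrable (fun y => cap (δ y * b)) μ :=
    integrable_cap (by fun_prop) fun y => abs_mul_le_one (h1 y) hb
  have hinj := SlowPolarization.strictMonoOn_cap.injOn
  have habs : ∀ y, |δ y| ∈ Set.Icc (0 : ℝ) 1 := fun y => ⟨abs_nonneg _, h1 y⟩
  -- At the endpoints `a = 0` and `a = 1`, where there is no tangent, `|δ|` is almost surely `a`.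
  rcases ha.1.eq_or_lt with rfl | ha0
  · rw [SlowPolarization.cap_zero] at he
    have h0 := (integral_eq_zero_iff_of_nonneg (fun y => (hc y).1) hi).1 he.symm
    refine le_of_eq ?_
    rw [integral_congr_ae (g := fun _ => cap (0 * b))]
    · simp
    filter_upwards [h0] with y hy
    have hy' : cap |δ y| = cap 0 := by
      rw [SlowPolarization.cap_abs, SlowPolarization.cap_zero]; exact hy
    rw [abs_eq_zero.1 (hinj (habs y) ⟨le_rfl, zero_le_one⟩ hy')]
  rcases ha.2.eq_or_lt with rfl | ha1
  · rw [SlowPolarization.cap_one] at he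
    have h0 : ∫ y, (1 - cap (δ y)) ∂μ = 0 := by
      rw [integral_sub (integrable_const _) hi, ← he]; simp
    have h0 := (integral_eq_zero_iff_of_nonneg (fun y => sub_nonneg.2 (hc y).2)
      ((integrable_const _).sub hi)).1 h0
    refine le_of_eq ?_
    rw [integral_congr_ae (g := fun _ => cap (1 * b))]
    · simp
    filter_upwards [h0] with y hy
    have hy' : cap |δ y| = cap 1 := by
      rw [SlowPolarization.cap_abs, SlowPolarization.cap_one]; exact (sub_eq_zero.1 hy).symm
    rw [← SlowPolarization.cap_abs, abs_mul, hinj (habs y) ⟨zero_le_one, le_rfl⟩ hy', one_mul,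
      one_mul, SlowPolarization.cap_abs]
  obtain ⟨c, hcc⟩ := SlowPolarization.exists_cap_mul_le (abs_nonneg b) hb ha0 ha1
  have hi' : Integrable (fun y => cap (δ y) - cap a) μ := hi.sub (integrable_const _)
  calc ∫ y, cap (δ y * b) ∂μ ≤ ∫ y, (cap (|b| * a) + c * (cap (δ y) - cap a)) ∂μ := by
        refine integral_mono hib ((integrable_const _).add (hi'.const_mul _))
          fun y => ?_
        have := hcc |δ y| (habs y)
        rwa [← abs_mul, SlowPolarization.cap_abs, SlowPolarization.cap_abs, mul_comm b] at this
    _ = cap (a * b) := by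
        rw [integral_add (integrable_const _) (hi'.const_mul _),
          integral_const_mul, integral_sub hi (integrable_const _), ← he]
        simp only [integral_const, probReal_univ, one_smul, sub_self, mul_zero, add_zero]
        rw [← SlowPolarization.cap_abs (a * b), abs_mul, abs_of_pos ha0, mul_comm]

/-- Mrs. Gerber's lemma: among channels of given symmetric capacities, the binary symmetric ones
maximize the capacity of `minus`. -/
theorem I_minus_le (W V : BinaryChannel.{u}) {a b : ℝ} (ha : a ∈ Set.Icc (0 : ℝ) 1)
    (hb : b ∈ Set.Icc (0 : ℝ) 1) (hW : cap a = W.I) (hV : cap b = V.I) :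
    (minus W V).I ≤ cap (a * b) := by
  obtain ⟨δ, hδ⟩ := W.exists_isBias
  obtain ⟨ε, hε⟩ := V.exists_isBias
  have h1 := hδ.measurable
  have h2 := hε.measurable
  have i3 : Integrable (fun p : W.Out × V.Out => cap (δ p.1 * ε p.2))
      (W.outLaw.prod V.outLaw) :=
    integrable_cap (by fun_prop) fun p => abs_mul_le_one (hδ.abs_le_one p.1) (hε.abs_le_one p.2)
  have ha1 : |a| ≤ 1 := abs_le.2 ⟨by linarith [ha.1], ha.2⟩
  rw [I_minus_eq hδ hε, integral_prod_symm _ i3]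
  calc _ ≤ ∫ z, cap (a * ε z) ∂V.outLaw :=
        integral_mono i3.integral_prod_right
          (integrable_cap (by fun_prop) fun z => abs_mul_le_one ha1 (hε.abs_le_one z))
          fun z => integral_cap_mul_le h1 hδ.abs_le_one ha (hε.abs_le_one z)
            (hW.trans hδ.I_eq)
    _ ≤ cap (a * b) := by
        simp only [mul_comm a]
        exact integral_cap_mul_le h2 hε.abs_le_one hb ha1 (hV.trans hε.I_eq)

/-- Among channels of given symmetric capacities, the erasure channels minimize the capacity of
`minus`; see `IsErasure.I_minus` for equality. -/
theorem I_mul_I_le (W V : BinaryChannel.{u}) : W.I * V.I ≤ (minus W V).I := by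
  obtain ⟨δ, hδ⟩ := W.exists_isBias
  obtain ⟨ε, hε⟩ := V.exists_isBias
  have h1 := hδ.measurable
  have h2 := hε.measurable
  rw [I_minus_eq hδ hε, hδ.I_eq, hε.I_eq, ← integral_prod_mul]
  exact integral_mono
    ((integrable_cap h1 hδ.abs_le_one).mul_prod (integrable_cap h2 hε.abs_le_one))
    (integrable_cap (by fun_prop) fun p => abs_mul_le_one (hδ.abs_le_one p.1) (hε.abs_le_one p.2))
    fun p => SlowPolarization.cap_mul_cap_le (hδ.abs_le_one p.1) (hε.abs_le_one p.2)

/-! ### Erasure channels -/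

/-- `W` is an erasure channel: each output either reveals the input or is independent of it. -/
def IsErasure (W : BinaryChannel.{u}) : Prop :=
  ∃ δ, IsBias W δ ∧ ∀ y, δ y = 0 ∨ δ y = 1 ∨ δ y = -1

lemma IsErasure.minus {W V : BinaryChannel.{u}} (hW : W.IsErasure) (hV : V.IsErasure) :
    (BinaryChannel.minus W V).IsErasure := by
  obtain ⟨δ, hδ, hδ'⟩ := hW
  obtain ⟨ε, hε, hε'⟩ := hV
  refine ⟨_, (hδ.minus hε).2, fun p => ?_⟩
  rcases hδ' p.1 with h | h | h <;> rcases hε' p.2 with h' | h' | h' <;> simp [h, h']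

lemma IsErasure.plus {W V : BinaryChannel.{u}} (hW : W.IsErasure) (hV : V.IsErasure) :
    (BinaryChannel.plus W V).IsErasure := by
  obtain ⟨δ, hδ, hδ'⟩ := hW
  obtain ⟨ε, hε, hε'⟩ := hV
  refine ⟨_, (hδ.plus hε).2, fun ⟨y, z, u⟩ => ?_⟩
  cases u <;> rcases hδ' y with h | h | h <;> rcases hε' z with h' | h' | h' <;>
    norm_num [plusBias, h, h']

/-- For erasure channels `cap` is multiplicative on the values `0`, `1` and `-1` of the biases. -/
theorem IsErasure.I_minus {W V : BinaryChannel.{u}} (hW : W.IsErasure) (hV : V.IsErasure) :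
    (BinaryChannel.minus W V).I = W.I * V.I := by
  obtain ⟨δ, hδ, hδ'⟩ := hW
  obtain ⟨ε, hε, hε'⟩ := hV
  rw [I_minus_eq hδ hε, hδ.I_eq, hε.I_eq, ← integral_prod_mul]
  refine integral_congr_ae (.of_forall fun p => ?_)
  rcases hδ' p.1 with h | h | h <;> rcases hε' p.2 with h' | h' | h' <;>
    simp [h, h', SlowPolarization.cap_neg]

end BinaryChannel

namespace SlowPolarization

/-! ### The recursions for `F` and `G` -/

/-- The bias `1 - 2p` of a binary symmetric channel whose crossover probability `p ≤ 1/2` has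
entropy `t`. -/
noncomputable def bias (t : ℝ) : ℝ := 1 - 2 * hInv t

lemma bias_mem_and_cap_bias {t : ℝ} (ht : t ∈ Set.Icc (0 : ℝ) 1) :
    bias t ∈ Set.Icc (0 : ℝ) 1 ∧ cap (bias t) = 1 - t := by
  have hex : ∃ p ∈ Set.Icc (0 : ℝ) (1 / 2), h p = t := by
    obtain ⟨x, hx, hx'⟩ := exists_cap_eq (t := 1 - t) ⟨by linarith [ht.2], by linarith [ht.1]⟩
    refine ⟨(1 - x) / 2, ⟨by linarith [hx.2], by linarith [hx.1]⟩, ?_⟩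
    rw [cap] at hx'
    linarith
  have h1 : hInv t ∈ Set.Icc (0 : ℝ) (1 / 2) := Function.invFunOn_mem hex
  have h2 : h (hInv t) = t := Function.invFunOn_eq hex
  refine ⟨⟨by unfold bias; linarith [h1.2], by unfold bias; linarith [h1.1]⟩, ?_⟩
  rw [cap, bias, show (1 - (1 - 2 * hInv t)) / 2 = hInv t by ring, h2]

lemma g_eq (t x : ℝ) : g t x = 2 * x - 1 + cap (bias t * bias (2 * x - t)) := by
  have : (1 - bias t * bias (2 * x - t)) / 2 = conv (hInv t) (hInv (2 * x - t)) := by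
    unfold bias conv; ring
  rw [g, cap, this]; ring

variable {s t x : ℝ}

lemma mem_Icc_of_mem_dom (hx : x ≤ 1) (ht : t ∈ dom x) :
    t ∈ Set.Icc (0 : ℝ) 1 ∧ 2 * x - t ∈ Set.Icc (0 : ℝ) 1 := by
  obtain ⟨h1, h2⟩ := ht
  rw [max_le_iff] at h1
  exact ⟨⟨h1.1, h2.trans hx⟩, by linarith, by linarith⟩

lemma self_mem_dom (hx : x ∈ Set.Icc (0 : ℝ) 1) : x ∈ dom x :=
  ⟨max_le hx.1 (by linarith [hx.2]), le_rfl⟩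

lemma f_mono (hs : s ≤ t) (ht : t ≤ x) : f s x ≤ f t x := by
  unfold f
  nlinarith [mul_nonneg (sub_nonneg.2 hs) (sub_nonneg.2 ht),
    mul_nonneg (sub_nonneg.2 hs) (sub_nonneg.2 (hs.trans ht))]

lemma f_mem_dom (hx : x ≤ 1) (ht : t ∈ dom x) : f t x ∈ dom x := by
  obtain ⟨h1, h2⟩ := mem_Icc_of_mem_dom hx ht
  have h3 := mul_nonneg (sub_nonneg.2 h1.2) (sub_nonneg.2 h2.2)
  have h4 := mul_nonneg h1.1 (sub_nonneg.2 h2.2)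
  have h5 := ht.2
  refine ⟨max_le (mul_nonneg h1.1 h2.1) ?_, ?_⟩ <;> unfold f <;> linarith

/-- Moving `t` towards `x` brings the two biases closer to each other at constant total capacity,
which increases their product. -/
lemma g_mono (hx : x ≤ 1) (hs : s ∈ dom x) (ht : t ∈ dom x) (hst : s ≤ t) : g s x ≤ g t x := by
  obtain ⟨s1, s2⟩ := mem_Icc_of_mem_dom hx hs
  obtain ⟨t1, t2⟩ := mem_Icc_of_mem_dom hx ht
  obtain ⟨a1, a1'⟩ := bias_mem_and_cap_bias s1
  obtain ⟨b1, b1'⟩ := bias_mem_and_cap_bias s2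
  obtain ⟨a2, a2'⟩ := bias_mem_and_cap_bias t1
  obtain ⟨b2, b2'⟩ := bias_mem_and_cap_bias t2
  have h1 := (strictMonoOn_cap.le_iff_le b1 b2).1 (by linarith)
  have h2 := (strictMonoOn_cap.le_iff_le b2 a2).1 (by linarith [ht.2])
  have h3 := (strictMonoOn_cap.le_iff_le a2 a1).1 (by linarith)
  rw [g_eq, g_eq]
  have := strictMonoOn_cap.monotoneOn ⟨mul_nonneg a1.1 b1.1, mul_le_one₀ a1.2 b1.1 b1.2⟩
    ⟨mul_nonneg a2.1 b2.1, mul_le_one₀ a2.2 b2.1 b2.2⟩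
    (mul_le_mul_of_cap_add_eq b1.1 h1 h2 h3 a1.2 (by linarith))
  linarith

/-- With `a` and `b` the biases of `t` and `2x - t`, the lower bounds are `cap (a * b) ≥ 0` and
`cap (a * b) ≥ cap a * cap b ≥ cap a + cap b - 1`, the upper bound is `cap (a * b) ≤ cap b`. -/
lemma g_mem_dom (hx : x ≤ 1) (ht : t ∈ dom x) : g t x ∈ dom x := by
  obtain ⟨h1, h2⟩ := mem_Icc_of_mem_dom hx ht
  obtain ⟨a, a'⟩ := bias_mem_and_cap_bias h1
  obtain ⟨b, b'⟩ := bias_mem_and_cap_bias h2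
  have ha : |bias t| ≤ 1 := by rw [abs_of_nonneg a.1]; exact a.2
  have hb : |bias (2 * x - t)| ≤ 1 := by rw [abs_of_nonneg b.1]; exact b.2
  have hab : bias t * bias (2 * x - t) ∈ Set.Icc (0 : ℝ) 1 :=
    ⟨mul_nonneg a.1 b.1, mul_le_one₀ a.2 b.1 b.2⟩
  have h3 := (cap_mem (x := bias t * bias (2 * x - t)) (by rw [abs_of_nonneg hab.1]; exact hab.2)).1
  have h4 := cap_mul_cap_le ha hb
  have h5 := strictMonoOn_cap.monotoneOn hab b (mul_le_of_le_one_left b.1 a.2)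
  rw [a', b'] at h4
  have h6 := mul_nonneg h1.1 h2.1
  have h7 := ht.2
  rw [g_eq]
  refine ⟨max_le ?_ ?_, ?_⟩ <;> linarith

lemma F_mem_dom (hx : x ∈ Set.Icc (0 : ℝ) 1) : ∀ n, F n x ∈ dom x
  | 0 => self_mem_dom hx
  | n + 1 => f_mem_dom hx.2 (F_mem_dom hx n)

lemma G_mem_dom (hx : x ∈ Set.Icc (0 : ℝ) 1) : ∀ n, G n x ∈ dom x
  | 0 => self_mem_dom hx
  | n + 1 => g_mem_dom hx.2 (G_mem_dom hx n)

end SlowPolarization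

namespace BinaryChannel

open SlowPolarization (cap)

/-! ### Capacities under slow polarization -/

lemma I_L_add_I_R (W : BinaryChannel.{u}) : ∀ n, (W.L n).I + (W.R n).I = 2 * W.I
  | 0 => (two_mul _).symm
  | n + 1 => (I_minus_add_I_plus (W.L n) (W.R n)).trans (W.I_L_add_I_R n)

lemma one_sub_I_R_succ (W : BinaryChannel.{u}) (n : ℕ) :
    1 - (W.R (n + 1)).I = 2 * (1 - W.I) - 1 + (minus (W.L n) (W.R n)).I := by
  have h : (minus (W.L n) (W.R n)).I + (W.R (n + 1)).I = 2 * W.I := W.I_L_add_I_R (n + 1)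
  linarith

/-- With `x = 1 - I(W)` and `t = 1 - I(R_n)`, one has `1 - I(L_n) = 2x - t`, and the two extremal
inequalities for `minus` say `f(t, x) ≤ 1 - I(R_{n+1}) ≤ g(t, x)`. Monotonicity of `f` and `g` in `t`
carries the bounds through the induction. -/
theorem one_sub_I_R_mem (W : BinaryChannel.{u}) (n : ℕ) :
    1 - (W.R n).I ∈
      Set.Icc (SlowPolarization.F n (1 - W.I)) (SlowPolarization.G n (1 - W.I)) := by
  have hI := W.I_mem
  have hx : 1 - W.I ∈ Set.Icc (0 : ℝ) 1 := ⟨by linarith [hI.2], by linarith [hI.1]⟩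
  induction n with
  | zero => exact ⟨le_rfl, le_rfl⟩
  | succ n ih =>
    have hF := SlowPolarization.F_mem_dom hx n
    have hG := SlowPolarization.G_mem_dom hx n
    have ht : 1 - (W.R n).I ∈ SlowPolarization.dom (1 - W.I) :=
      ⟨hF.1.trans ih.1, ih.2.trans hG.2⟩
    have hLR := W.I_L_add_I_R n
    rw [one_sub_I_R_succ]
    constructor
    · refine (SlowPolarization.f_mono ih.1 ht.2).trans ?_
      have := I_mul_I_le (W.L n) (W.R n)
      rw [show (W.L n).I = 2 * W.I - (W.R n).I by linarith] at this
      unfold SlowPolarization.f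
      linarith
    · refine le_trans ?_ (SlowPolarization.g_mono hx.2 ht hG ih.2)
      obtain ⟨h1, h2⟩ := SlowPolarization.mem_Icc_of_mem_dom hx.2 ht
      obtain ⟨a, a'⟩ := SlowPolarization.bias_mem_and_cap_bias h1
      obtain ⟨b, b'⟩ := SlowPolarization.bias_mem_and_cap_bias h2
      have := I_minus_le (W.L n) (W.R n) b a (by linarith) (by linarith)
      rw [SlowPolarization.g_eq, mul_comm (SlowPolarization.bias _)]
      linarith

lemma IsErasure.slow {W : BinaryChannel.{u}} (hW : W.IsErasure) :
    ∀ n, (W.L n).IsErasure ∧ (W.R n).IsErasure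
  | 0 => ⟨hW, hW⟩
  | n + 1 => ⟨(hW.slow n).1.minus (hW.slow n).2, (hW.slow n).1.plus (hW.slow n).2⟩

theorem IsErasure.one_sub_I_R {W : BinaryChannel.{u}} (hW : W.IsErasure) (n : ℕ) :
    1 - (W.R n).I = SlowPolarization.F n (1 - W.I) := by
  induction n with
  | zero => rfl
  | succ n ih =>
    have hLR := W.I_L_add_I_R n
    rw [one_sub_I_R_succ, IsErasure.I_minus (hW.slow n).1 (hW.slow n).2, SlowPolarization.F, ← ih,
      show (W.L n).I = 2 * W.I - (W.R n).I by linarith, SlowPolarization.f]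
    ring

/-- The bias of the binary erasure channel. -/
def becBias (y : Option Bool) : ℝ := y.elim 0 sgn

lemma bec_isErasure_and_I (ε : unitInterval) : (bec ε).IsErasure ∧ (bec ε).I = 1 - ε := by
  let _ : MeasurableSpace (Option Bool) := ⊤
  have h0 : (0 : ℝ) ≤ ε := ε.2.1
  have h1 : (0 : ℝ) ≤ 1 - ε := sub_nonneg.2 ε.2.2
  set μ : Measure (Option Bool) := ENNReal.ofReal ((1 - ε) / 2) •
    (Measure.dirac (some false) + Measure.dirac (some true)) + ENNReal.ofReal ε • Measure.dirac none
    with hμ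
  have hm : Measurable becBias := measurable_from_top
  have hv : ∀ y, becBias y = 0 ∨ becBias y = 1 ∨ becBias y = -1 := by
    rintro (_ | _ | _) <;> simp [becBias]
  have hb : ∀ y, |becBias y| ≤ 1 := by
    intro y; rcases hv y with h | h | h <;> simp [h]
  obtain ⟨ho, hB⟩ := isBias_of_law_eq (W := bec ε) (μ := μ) (δ := becBias) hm hb fun x => by
    change ENNReal.ofReal (1 - ε) • Measure.dirac (some x) + ENNReal.ofReal ε • Measure.dirac none
      = μ.withDensity fun y => ENNReal.ofReal (1 + sgn x * becBias y)
    have e2 : ENNReal.ofReal ((1 - ε) / 2) * ENNReal.ofReal (1 + 1) = ENNReal.ofReal (1 - ε) := by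
      rw [← ENNReal.ofReal_mul (by linarith)]; congr 1; ring
    rw [hμ, withDensity_add_measure, withDensity_smul_measure, withDensity_smul_measure,
      withDensity_add_measure, dirac_withDensity, dirac_withDensity, dirac_withDensity]
    cases x <;> simp [becBias, smul_smul, e2]
  refine ⟨⟨becBias, hB, hv⟩, ?_⟩
  rw [hB.I_eq, ho]
  change ∫ y, cap (becBias y) ∂μ = 1 - ε
  have hfin : ∀ (c : ℝ) (ν : Measure (Option Bool)) [IsFiniteMeasure ν],
      Integrable (fun y => cap (becBias y)) (ENNReal.ofReal c • ν) := fun c ν _ =>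
    (integrable_cap hm hb).smul_measure ENNReal.ofReal_ne_top
  rw [hμ, integral_add_measure (hfin _ _) (hfin _ _), integral_smul_measure,
    integral_smul_measure, integral_add_measure (integrable_cap hm hb) (integrable_cap hm hb),
    integral_dirac, integral_dirac, integral_dirac, ENNReal.toReal_ofReal (by linarith)]
  simp [becBias, SlowPolarization.cap_neg]
  ring

end BinaryChannel

theorem proposition2 :
    -- the iterates stay in the domain of `f(·,x)` and `g(·,x)`, so that they are well defined
    (∀ x ∈ Set.Icc (0 : ℝ) 1, ∀ n : ℕ,
      SlowPolarization.F n x ∈ SlowPolarization.dom x ∧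
      SlowPolarization.G n x ∈ SlowPolarization.dom x) ∧
    -- the two bounds, for every binary-input channel
    (∀ W : BinaryChannel.{u}, W.I ∈ Set.Icc (0 : ℝ) 1 ∧
      ∀ n : ℕ, 1 - SlowPolarization.G n (1 - W.I) ≤ (W.R n).I ∧
        (W.R n).I ≤ 1 - SlowPolarization.F n (1 - W.I)) ∧
    -- the upper bound is attained by the binary erasure channel, at every value of the capacity
    (∀ ε : unitInterval, (BinaryChannel.bec ε).I = 1 - ε ∧
      ∀ n : ℕ, ((BinaryChannel.bec ε).R n).I =
        1 - SlowPolarization.F n (1 - (BinaryChannel.bec ε).I)) := by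
  refine ⟨fun x hx n => ⟨SlowPolarization.F_mem_dom hx n, SlowPolarization.G_mem_dom hx n⟩,
    fun W => ⟨W.I_mem, fun n => ?_⟩, fun ε => ?_⟩
  · have := W.one_sub_I_R_mem n
    constructor <;> linarith [this.1, this.2]
  · obtain ⟨h1, h2⟩ := BinaryChannel.bec_isErasure_and_I ε
    exact ⟨h2, fun n => by linarith [h1.one_sub_I_R n]⟩
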